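/- A left-invariant linear order on a group $G$ is a total order $\preceq$ with $x\preceq y\Rightarrow gx\preceq gy$ for all $g,x,y\in G$. Let $\mathrm{LO}(G)$ be the set of all such orders, with the topology generated by the sets $\{\preceq' \mid x\preceq' y \Leftrightarrow x\preceq y \text{ for all } x,y\in X\}$, where $\preceq\,\in\mathrm{LO}(G)$ and $X\subset G$ is finite. An isolated linear order on $G$ is an isolated point of $\mathrm{LO}(G)$. For $n\ge 0$ let $\mathcal G_n$ be the space of groups marked by $n$ generators: its points are the pairs $(G,(s_1,\dots,s_n))$ of a group $G$ and an ordered generating tuple, up to isomorphisms that respect the tuples. Equivalently, its points are the normal subgroups $N$ of the free group $F_n$, with $G=F_n/N$. Its topology is generated by the sets of all $N'$ with $N'\cap X=N\cap X$, where $N\trianglelefteq F_n$ and $X\subset F_n$ is finite. The space of finitely generated marked groups is the disjoint union $\mathcal G=\bigsqcup_{n\ge 0}\mathcal G_n$. Corollary 1.3. In the space $\mathcal G$ of finitely generated marked groups, having an isolated linear order is neither a closed nor an open property: the set of marked groups $(G,S)\in\mathcal G$ such that $G$ has an isolated linear order is neither closed nor open in $\mathcal G$. Moreover, for every $n\ge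 2$, the set of $(G,S)\in\mathcal G_n$ such that $G$ has an isolated linear order is neither closed nor open in $\mathcal G_n$. -/

import Mathlib

/-- A left-invariant linear order on `G`: a total order invariant under left multiplication. -/
structure LeftOrder (G : Type*) [Group G] where
  le : G → G → Prop
  le_refl : ∀ a, le a a
  le_trans : ∀ a b c, le a b → le b c → le a c
  le_antisymm : ∀ a b, le a b → le b a → a = b
  le_total : ∀ a b, le a b ∨ le b a
  mul_left : ∀ c a b, le a b → le (c * a) (c * b)

namespace LeftOrder

variable {G : Type*} [Group G]

/-- The basic open set of all left orders that agree with `P` on the finite set `X`. -/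
def cylinder (P : LeftOrder G) (X : Finset G) : Set (LeftOrder G) :=
  {Q | ∀ x ∈ X, ∀ y ∈ X, (Q.le x y ↔ P.le x y)}

/-- The space of linear orders on `G`: the topology generated by the sets `cylinder P X`. -/
instance : TopologicalSpace (LeftOrder G) :=
  TopologicalSpace.generateFrom {U | ∃ (P : LeftOrder G) (X : Finset G), U = cylinder P X}

/-- `P` is an isolated order: an isolated point of the space of linear orders on `G`. -/
def IsIsolated (P : LeftOrder G) : Prop :=
  IsOpen ({P} : Set (LeftOrder G))

end LeftOrder

/-- The group `G` has an isolated linear order. -/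
def HasIsolatedLinearOrder (G : Type*) [Group G] : Prop :=
  ∃ P : LeftOrder G, P.IsIsolated

/-- The set of groups marked by `n` generators. A marked group `(G, (s₁, …, sₙ))`, with
`s₁, …, sₙ` generating `G` and up to isomorphisms of groups that respect the ordered generating
tuples, is the same thing as the normal subgroup of all relations, that is, the kernel of the
epimorphism `F_n → G` that sends the `i`-th free generator to `sᵢ`. -/
structure MarkedGroup (n : ℕ) where
  relations : Subgroup (FreeGroup (Fin n))
  normal : relations.Normal

namespace MarkedGroup

variable {n : ℕ}

instance (M : MarkedGroup n) : M.relations.Normal := M.normal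

/-- The underlying group of a marked group. -/
abbrev Carrier (M : MarkedGroup n) : Type := FreeGroup (Fin n) ⧸ M.relations

/-- The basic open set of all marked groups in which the same words from the finite set `X`
are relations as in `M`. -/
def cylinder (M : MarkedGroup n) (X : Finset (FreeGroup (Fin n))) : Set (MarkedGroup n) :=
  {N | ∀ w ∈ X, (w ∈ N.relations ↔ w ∈ M.relations)}

/-- The space of groups marked by `n` generators: two marked groups are close if they have the
same relations in a large finite set of words. -/
instance : TopologicalSpace (MarkedGroup n) :=
  TopologicalSpace.generateFrom
    {U | ∃ (M : MarkedGroup n) (X : Finset (FreeGroup (Fin n))), U = cylinder M X}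

end MarkedGroup

/-- The space of all finitely generated marked groups: the disjoint union, over all `n`, of the
spaces of groups marked by `n` generators, with the disjoint union topology. -/
abbrev FGMarkedGroup : Type := Σ n : ℕ, MarkedGroup n

/-! Not open: `ℤ` is a limit of the finite cyclic groups `ℤ/(k+2)`. The order on `ℤ` is isolated,
while groups with torsion have no left order.

Not closed: let the Klein bottle group `⟨x, u | x u x⁻¹ = u⁻¹⟩` act on a ring `R` with a unit `t`,
`x` by multiplication by `t` and `u` by `-1`. In the semidirect product take the subgroup generated
by `x` and `(1, u)`; it contains the translation by `t - 1`. Because `u` inverts the translations,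
they form a convex subgroup in every left order (`KleinExtension.one_le_mul_of_mem`), so an order is
given by the signs of `x` and `u` and its restriction to the translations. For `t = k + 2` in `ℚ`
the translations have rank one, and one more sign fixes the order: it is isolated. For `t = T` in
`ℤ[T;T⁻¹]` they have infinite rank, and every order can be altered on them away from a given finite
set: none is isolated. The rational groups converge to the Laurent one, since a nonzero Laurent
polynomial vanishes at only finitely many `k + 2`. -/

/-! ### Left orders, positive cones and isolation -/

namespace LeftOrder

variable {G : Type*} [Group G]

theorem le_iff_one_le (P : LeftOrder G) (a b : G) : P.le a b ↔ P.le 1 (a⁻¹ * b) := by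
  constructor
  · intro h
    simpa using P.mul_left a⁻¹ a b h
  · intro h
    simpa using P.mul_left a 1 (a⁻¹ * b) h

theorem one_le_mul (P : LeftOrder G) {a b : G} (ha : P.le 1 a) (hb : P.le 1 b) :
    P.le 1 (a * b) :=
  P.le_trans _ a _ ha (by simpa using P.mul_left a 1 b hb)

theorem one_le_or_one_le_inv (P : LeftOrder G) (a : G) : P.le 1 a ∨ P.le 1 a⁻¹ := by
  rcases P.le_total 1 a with h | h
  · exact Or.inl h
  · right
    simpa using P.mul_left a⁻¹ a 1 h

theorem eq_one_of_one_le (P : LeftOrder G) {a : G} (ha : P.le 1 a) (ha' : P.le 1 a⁻¹) : a = 1 :=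
  P.le_antisymm _ _ (by simpa using P.mul_left a 1 a⁻¹ ha') ha

theorem one_le_pow (P : LeftOrder G) {a : G} (ha : P.le 1 a) (k : ℕ) : P.le 1 (a ^ k) := by
  induction k with
  | zero => simpa using P.le_refl 1
  | succ k ih => rw [pow_succ]; exact P.one_le_mul ih ha

/-- The left order whose set of nonnegative elements is `C`. -/
def ofCone (C : G → Prop) (one : C 1) (mul : ∀ a b, C a → C b → C (a * b))
    (antisymm : ∀ a, C a → C a⁻¹ → a = 1) (total : ∀ a, C a ∨ C a⁻¹) : LeftOrder G where
  le a b := C (a⁻¹ * b)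
  le_refl a := by simpa using one
  le_trans a b c hab hbc := by simpa [mul_assoc] using mul _ _ hab hbc
  le_antisymm a b hab hba := by
    have := antisymm _ hab (by simpa using hba)
    exact (inv_mul_eq_one.1 this)
  le_total a b := by simpa using total (a⁻¹ * b)
  mul_left c a b h := by simpa [mul_assoc] using h

theorem ofCone_le {C : G → Prop} {one mul antisymm total} (a b : G) :
    (ofCone C one mul antisymm total).le a b ↔ C (a⁻¹ * b) := Iff.rfl

/-- The pullback of a left order along an injective homomorphism. -/
def comap {H : Type*} [Group H] (f : G →* H) (hf : Function.Injective f) (P : LeftOrder H) :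
    LeftOrder G where
  le a b := P.le (f a) (f b)
  le_refl a := P.le_refl _
  le_trans a b c := P.le_trans _ _ _
  le_antisymm a b hab hba := hf (P.le_antisymm _ _ hab hba)
  le_total a b := P.le_total _ _
  mul_left c a b h := by simpa using P.mul_left (f c) _ _ h

theorem ext_le {P Q : LeftOrder G} (h : ∀ a b, P.le a b ↔ Q.le a b) : P = Q := by
  cases P
  cases Q
  congr
  ext a b
  exact h a b

/-- One inclusion suffices: by totality and antisymmetry no positive cone properly contains another.
-/
theorem eq_of_one_le_imp {P Q : LeftOrder G} (h : ∀ a, P.le 1 a → Q.le 1 a) : Q = P := by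
  have h' : ∀ a, Q.le 1 a → P.le 1 a := fun a ha ↦ by
    rcases P.one_le_or_one_le_inv a with h1 | h1
    · exact h1
    · rw [Q.eq_one_of_one_le ha (h _ h1)]
      exact P.le_refl 1
  refine ext_le fun a b ↦ ?_
  rw [Q.le_iff_one_le, P.le_iff_one_le]
  exact ⟨h' _, h _⟩

theorem exists_cylinder_subset {U : Set (LeftOrder G)} (hU : IsOpen U) {P : LeftOrder G}
    (hP : P ∈ U) : ∃ X : Finset G, cylinder P X ⊆ U := by
  classical
  induction hU with
  | basic s hs =>
    obtain ⟨P', X, rfl⟩ := hs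
    exact ⟨X, fun Q hQ x hx y hy ↦ (hQ x hx y hy).trans (hP x hx y hy)⟩
  | univ => exact ⟨∅, Set.subset_univ _⟩
  | inter s t _ _ hs ht =>
    obtain ⟨X, hX⟩ := hs hP.1
    obtain ⟨Y, hY⟩ := ht hP.2
    refine ⟨X ∪ Y, fun Q hQ ↦ ⟨hX fun x hx y hy ↦ ?_, hY fun x hx y hy ↦ ?_⟩⟩
    · exact hQ x (Finset.mem_union_left _ hx) y (Finset.mem_union_left _ hy)
    · exact hQ x (Finset.mem_union_right _ hx) y (Finset.mem_union_right _ hy)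
  | sUnion S _ ih =>
    obtain ⟨s, hs, hPs⟩ := hP
    obtain ⟨X, hX⟩ := ih s hs hPs
    exact ⟨X, hX.trans (Set.subset_sUnion_of_mem hs)⟩

theorem isIsolated_iff (P : LeftOrder G) :
    P.IsIsolated ↔ ∃ X : Finset G, ∀ Q ∈ cylinder P X, Q = P := by
  constructor
  · intro h
    exact exists_cylinder_subset h rfl
  · rintro ⟨X, hX⟩
    have : ({P} : Set (LeftOrder G)) = cylinder P X := by
      ext Q
      exact ⟨by rintro rfl x _ y _; rfl, hX Q⟩
    rw [IsIsolated, this]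
    exact TopologicalSpace.isOpen_generateFrom_of_mem ⟨P, X, rfl⟩

/-- An order is isolated if it is determined by the positivity of finitely many of its positive
elements. -/
theorem isIsolated_of_forall_one_le {P : LeftOrder G} (X : Finset G) (hX : ∀ a ∈ X, P.le 1 a)
    (h : ∀ Q : LeftOrder G, (∀ a ∈ X, Q.le 1 a) → ∀ a, P.le 1 a → Q.le 1 a) : P.IsIsolated := by
  classical
  refine P.isIsolated_iff.2 ⟨insert 1 X, fun Q hQ ↦ eq_of_one_le_imp (h Q fun a ha ↦ ?_)⟩
  exact (hQ 1 (Finset.mem_insert_self _ _) a (Finset.mem_insert_of_mem ha)).2 (hX a ha)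

/-- A left-orderable group is torsion-free. -/
theorem eq_one_of_pow_eq_one (P : LeftOrder G) {a : G} {k : ℕ} (h : a ^ (k + 1) = 1) : a = 1 := by
  have key : ∀ b : G, b ^ (k + 1) = 1 → P.le 1 b → b = 1 := fun b hb h1 ↦ by
    refine P.eq_one_of_one_le h1 ?_
    -- The inverse of a torsion element is one of its nonnegative powers.
    rw [inv_eq_of_mul_eq_one_left (a := b ^ k) (by rwa [← pow_succ])]
    exact P.one_le_pow h1 k
  rcases P.one_le_or_one_le_inv a with h1 | h1
  · exact key a h h1
  · exact inv_eq_one.1 (key _ (by simp [h]) h1)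

end LeftOrder

/-! ### Convergence of marked groups -/

namespace MarkedGroup

variable {n : ℕ}

theorem exists_cylinder_subset {U : Set (MarkedGroup n)} (hU : IsOpen U) {M : MarkedGroup n}
    (hM : M ∈ U) : ∃ X : Finset (FreeGroup (Fin n)), cylinder M X ⊆ U := by
  classical
  induction hU with
  | basic s hs =>
    obtain ⟨M', X, rfl⟩ := hs
    exact ⟨X, fun N hN x hx ↦ (hN x hx).trans (hM x hx)⟩
  | univ => exact ⟨∅, Set.subset_univ _⟩
  | inter s t _ _ hs ht =>
    obtain ⟨X, hX⟩ := hs hM.1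
    obtain ⟨Y, hY⟩ := ht hM.2
    refine ⟨X ∪ Y, fun N hN ↦ ⟨hX fun x hx ↦ ?_, hY fun x hx ↦ ?_⟩⟩
    · exact hN x (Finset.mem_union_left _ hx)
    · exact hN x (Finset.mem_union_right _ hx)
  | sUnion S _ ih =>
    obtain ⟨s, hs, hMs⟩ := hM
    obtain ⟨X, hX⟩ := ih s hs hMs
    exact ⟨X, hX.trans (Set.subset_sUnion_of_mem hs)⟩

open Filter in
/-- A sequence of marked groups converges if every word is eventually a relation exactly when it
is a relation in the limit. -/
theorem exists_mem_of_isOpen {U : Set (MarkedGroup n)} (hU : IsOpen U) {M : MarkedGroup n}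
    (hM : M ∈ U) (N : ℕ → MarkedGroup n)
    (h : ∀ w, ∀ᶠ k in atTop, (w ∈ (N k).relations ↔ w ∈ M.relations)) : ∃ k, N k ∈ U := by
  obtain ⟨X, hX⟩ := exists_cylinder_subset hU hM
  obtain ⟨k, hk⟩ := ((eventually_all_finset X).2 fun w _ ↦ h w).exists
  exact ⟨k, hX hk⟩

/-- The marked group given by the tuple of images of the free generators under `f`. -/
def ofHom {H : Type*} [Group H] (f : FreeGroup (Fin n) →* H) : MarkedGroup n where
  relations := f.ker
  normal := inferInstance

end MarkedGroup

/-! ### Failure of openness: cyclic groups -/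

/-- An infinite cyclic group has an isolated linear order. -/
theorem hasIsolatedLinearOrder_of_zpowers {G : Type*} [Group G]
    (f : G →* Multiplicative ℤ) (hf : Function.Injective f) (s : G)
    (hs : f s = Multiplicative.ofAdd 1) : HasIsolatedLinearOrder G := by
  let Z : LeftOrder (Multiplicative ℤ) := LeftOrder.ofCone (fun a ↦ 0 ≤ a.toAdd) (by simp)
    (fun a b ha hb ↦ by rw [toAdd_mul]; omega)
    (fun a ha hb ↦ by
      rw [toAdd_inv] at hb
      exact Multiplicative.toAdd.injective (by rw [toAdd_one]; omega))
    (fun a ↦ by rw [toAdd_inv]; omega)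
  have hZ : ∀ g, (LeftOrder.comap f hf Z).le 1 g ↔ 0 ≤ (f g).toAdd := fun g ↦ by
    change 0 ≤ ((f 1)⁻¹ * f g).toAdd ↔ _
    simp
  refine ⟨LeftOrder.comap f hf Z, LeftOrder.isIsolated_of_forall_one_le {s} ?_ ?_⟩
  · simp only [Finset.mem_singleton, forall_eq, hZ, hs]
    simp
  · intro Q hQ a ha
    rw [hZ] at ha
    obtain ⟨k, hk⟩ := Int.eq_ofNat_of_zero_le ha
    have : a = s ^ k := hf (by
      rw [map_pow, hs]
      apply Multiplicative.toAdd.injective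
      simp [hk])
    rw [this]
    exact Q.one_le_pow (hQ s (by simp)) k

open Filter in
theorem not_isOpen_hasIsolatedLinearOrder {n : ℕ} (hn : 1 ≤ n) :
    ¬ IsOpen {M : MarkedGroup n | HasIsolatedLinearOrder M.Carrier} := by
  intro hU
  let i : Fin n := ⟨0, hn⟩
  let e : FreeGroup (Fin n) →* Multiplicative ℤ :=
    FreeGroup.lift fun j ↦ if j = i then Multiplicative.ofAdd 1 else 1
  have he : e (FreeGroup.of i) = Multiplicative.ofAdd 1 := by simp [e]
  -- The modulus `k + 2` avoids `0` and `1`, whose quotients `ℤ` and the trivial group are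
  -- orderable.
  let q (k : ℕ) : Multiplicative ℤ →* Multiplicative (ZMod (k + 2)) :=
    AddMonoidHom.toMultiplicative (Int.castAddHom (ZMod (k + 2)))
  have hq (k : ℕ) (w) : w ∈ ((q k).comp e).ker ↔ ((k + 2 : ℕ) : ℤ) ∣ (e w).toAdd := by
    rw [← ZMod.intCast_zmod_eq_zero_iff_dvd]
    rfl
  obtain ⟨k, P, -⟩ := MarkedGroup.exists_mem_of_isOpen hU (M := MarkedGroup.ofHom e)
    (hasIsolatedLinearOrder_of_zpowers (QuotientGroup.kerLift e)
      (QuotientGroup.kerLift_injective e) (FreeGroup.of i : FreeGroup (Fin n)) he)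
    (fun k ↦ MarkedGroup.ofHom ((q k).comp e)) (fun w ↦ by
      -- Once the modulus exceeds the absolute value of the exponent sum, divisibility forces that
      -- sum to vanish.
      filter_upwards [eventually_gt_atTop (e w).toAdd.natAbs] with k hk
      refine (hq k w).trans ⟨fun h ↦ ?_, fun h ↦ ?_⟩
      · refine MonoidHom.mem_ker.2 (Multiplicative.toAdd.injective ?_)
        exact Int.eq_zero_of_dvd_of_natAbs_lt_natAbs h (by omega)
      · simp [MonoidHom.mem_ker.1 h])
  have hpow : ((FreeGroup.of i : FreeGroup (Fin n)) :
      (MarkedGroup.ofHom ((q k).comp e)).Carrier) ^ (k + 1 + 1) = 1 := by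
    rw [← QuotientGroup.mk_pow, QuotientGroup.eq_one_iff]
    refine (hq k _).2 ?_
    rw [map_pow, he, toAdd_pow, toAdd_ofAdd]
    exact dvd_of_eq (by push_cast; simp; ring)
  have h1 := (hq k _).1 ((QuotientGroup.eq_one_iff _).1 (P.eq_one_of_pow_eq_one hpow))
  rw [he] at h1
  have := Int.le_of_dvd one_pos h1
  omega

/-! ### Left orders on extensions of the Klein bottle group -/

/-- A group with a map to the Klein bottle group `⟨x, u | x u x⁻¹ = u⁻¹⟩`, whose elements are
written as `u ^ m * x ^ n`, and with lifts of the generators such that `u` inverts the elements of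
the kernel. -/
structure KleinExtension (G : Type*) [Group G] where
  n : G → ℤ
  m : G → ℤ
  x : G
  u : G
  n_mul : ∀ a b, n (a * b) = n a + n b
  m_mul : ∀ a b, m (a * b) = m a + ((n a).negOnePow : ℤ) * m b
  n_x : n x = 1
  n_u : n u = 0
  m_u : m u = 1
  u_mul : ∀ a, n a = 0 → m a = 0 → u * a = a⁻¹ * u

namespace KleinExtension

variable {G : Type*} [Group G] (D : KleinExtension G)

theorem n_one : D.n 1 = 0 := by
  have := D.n_mul 1 1
  simp at this
  exact this

theorem m_one : D.m 1 = 0 := by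
  have := D.m_mul 1 1
  simp [n_one] at this
  exact this

theorem n_inv (a : G) : D.n a⁻¹ = - D.n a := by
  have := D.n_mul a a⁻¹
  simp [n_one] at this
  omega

theorem m_inv (a : G) : D.m a⁻¹ = - (((D.n a).negOnePow : ℤ) * D.m a) := by
  have := D.m_mul a⁻¹ a
  simp [m_one, n_inv] at this
  omega

/-- The kernel of the map to the Klein bottle group. -/
def Mem (a : G) : Prop := D.n a = 0 ∧ D.m a = 0

variable {D}

theorem Mem.one : D.Mem 1 := ⟨D.n_one, D.m_one⟩

theorem Mem.inv {a : G} (ha : D.Mem a) : D.Mem a⁻¹ := by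
  simp [Mem, n_inv, m_inv, ha.1, ha.2]

theorem Mem.mul {a b : G} (ha : D.Mem a) (hb : D.Mem b) : D.Mem (a * b) := by
  simp [Mem, n_mul, m_mul, ha.1, ha.2, hb.1, hb.2]

theorem Mem.conj {a : G} (ha : D.Mem a) (g : G) : D.Mem (g * a * g⁻¹) := by
  have h := Int.units_mul_self (D.n g).negOnePow
  have h' : ((D.n g).negOnePow : ℤ) * ((D.n g).negOnePow : ℤ) = 1 := by
    rw [← Units.val_mul, h, Units.val_one]
  simp only [Mem, n_mul, m_mul, n_inv, m_inv, ha.1, ha.2, add_zero, mul_zero]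
  constructor
  · ring
  · linear_combination (-D.m g) * h'

theorem Mem.conj_inv {a : G} (ha : D.Mem a) (g : G) : D.Mem (g⁻¹ * a * g) := by
  simpa using ha.conj g⁻¹

variable (D)

/-- Replace `u` by its inverse. -/
def flipU : KleinExtension G where
  n := D.n
  m a := - D.m a
  x := D.x
  u := D.u⁻¹
  n_mul := D.n_mul
  m_mul a b := by rw [D.m_mul]; ring
  n_x := D.n_x
  n_u := by simp [n_inv, n_u]
  m_u := by simp [m_inv, n_u, m_u]
  u_mul a hn hm := by
    have := D.u_mul a⁻¹ (by simp [n_inv, hn]) (by simp [m_inv, neg_eq_zero.1 hm])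
    rw [inv_mul_eq_iff_eq_mul, ← mul_assoc, this, inv_inv, mul_assoc, mul_inv_cancel, mul_one]

/-- Replace `x` by its inverse. -/
def flipX : KleinExtension G where
  n a := - D.n a
  m := D.m
  x := D.x⁻¹
  u := D.u
  n_mul a b := by rw [D.n_mul]; ring
  m_mul a b := by rw [D.m_mul, Int.negOnePow_neg]
  n_x := by simp [n_inv, n_x]
  n_u := by simp [n_u]
  m_u := D.m_u
  u_mul a hn hm := D.u_mul a (neg_eq_zero.1 hn) hm

variable (P : LeftOrder G)

/-- Allows the signs of `x` and `u` to be normalised without changing the kernel. -/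
theorem exists_one_le : ∃ D' : KleinExtension G, (∀ a, D'.Mem a ↔ D.Mem a) ∧
    P.le 1 D'.x ∧ P.le 1 D'.u := by
  obtain ⟨D₁, h₁, hx⟩ : ∃ D' : KleinExtension G, (∀ a, D'.Mem a ↔ D.Mem a) ∧ P.le 1 D'.x := by
    rcases P.one_le_or_one_le_inv D.x with h | h
    · exact ⟨D, fun a ↦ Iff.rfl, h⟩
    · exact ⟨D.flipX, fun a ↦ and_congr neg_eq_zero Iff.rfl, h⟩
  rcases P.one_le_or_one_le_inv D₁.u with h | h
  · exact ⟨D₁, h₁, hx, h⟩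
  · exact ⟨D₁.flipU, fun a ↦ (and_congr Iff.rfl neg_eq_zero).trans (h₁ a), hx, h⟩

variable {D P}

/-- If instead `(u a)⁻¹ ≥ 1`, then `u (u a)⁻¹ = u a⁻¹ u⁻¹ = a` is nonnegative, and so is `u a`. -/
theorem one_le_u_mul (hu : P.le 1 D.u) {a : G} (ha : D.Mem a) : P.le 1 (D.u * a) := by
  rcases P.one_le_or_one_le_inv (D.u * a) with h | h
  · exact h
  · have h1 : P.le 1 a := by
      have := P.one_le_mul hu h
      rwa [mul_inv_rev, ← mul_assoc, D.u_mul a⁻¹ ha.inv.1 ha.inv.2, inv_inv,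
        mul_inv_cancel_right] at this
    exact P.one_le_mul hu h1

theorem one_le_of_m_pos (hu : P.le 1 D.u) {b : G} (hn : D.n b = 0) (hm : 0 < D.m b) :
    P.le 1 b := by
  obtain ⟨k, hk⟩ : ∃ k : ℕ, D.m b = k + 1 := ⟨(D.m b - 1).toNat, by omega⟩
  clear hm
  induction k generalizing b with
  | zero =>
    have := one_le_u_mul hu (a := D.u⁻¹ * b)
      (by simp [Mem, n_mul, m_mul, n_inv, m_inv, n_u, m_u, hn, hk])
    simpa using this
  | succ k ih =>
    have := P.one_le_mul hu (ih (b := D.u⁻¹ * b) (by simp [n_mul, n_inv, n_u, hn])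
      (by simp [m_mul, n_inv, m_inv, n_u, m_u, hk]))
    simpa using this

/-- Conjugation by `x` negates `m` where `n = 0`. For `m b < 0` this makes `x b x⁻¹` nonnegative,
whereas `(x b)⁻¹ ≥ 1` would make its inverse `x (x b)⁻¹` nonnegative too. -/
theorem one_le_x_mul (hx : P.le 1 D.x) (hu : P.le 1 D.u) {b : G} (hn : D.n b = 0) :
    P.le 1 (D.x * b) := by
  have key : ∀ b, D.n b = 0 → D.m b < 0 → P.le 1 (D.x * b) := fun b hn hm ↦ by
    rcases P.one_le_or_one_le_inv (D.x * b) with h | h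
    · exact h
    · have h1 : P.le 1 (D.x * b⁻¹ * D.x⁻¹) := by
        simpa [mul_assoc] using P.one_le_mul hx h
      have h2 : P.le 1 (D.x * b * D.x⁻¹) := by
        apply one_le_of_m_pos hu
        · simp [n_mul, n_inv, hn]
        · simp [n_mul, m_mul, m_inv, hn, n_x]
          omega
      have h3 := P.eq_one_of_one_le h2 (by simpa [mul_assoc] using h1)
      rw [conj_eq_one_iff] at h3
      simpa [h3] using hx
  rcases lt_trichotomy (D.m b) 0 with hm | hm | hm
  · exact key b hn hm
  -- For `b` in the kernel, split `x b = (x u⁻¹) (u b)`.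
  · have h1 := key D.u⁻¹ (by simp [n_inv, n_u]) (by simp [m_inv, n_u, m_u])
    simpa [mul_assoc] using P.one_le_mul h1 (one_le_u_mul hu ⟨hn, hm⟩)
  · exact P.one_le_mul hx (one_le_of_m_pos hu hn hm)

theorem one_le_of_n_pos (hx : P.le 1 D.x) (hu : P.le 1 D.u) {g : G} (hn : 0 < D.n g) :
    P.le 1 g := by
  obtain ⟨k, hk⟩ : ∃ k : ℕ, D.n g = k + 1 := ⟨(D.n g - 1).toNat, by omega⟩
  clear hn
  induction k generalizing g with
  | zero =>
    have := one_le_x_mul hx hu (b := D.x⁻¹ * g) (by simp [n_mul, n_inv, n_x, hk])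
    simpa using this
  | succ k ih =>
    have := P.one_le_mul hx (ih (g := D.x⁻¹ * g) (by simp [n_mul, n_inv, n_x, hk]))
    simpa using this

/-- The sign of an element outside the kernel is determined by its image. -/
theorem pos_of_one_le (hx : P.le 1 D.x) (hu : P.le 1 D.u) {g : G} (hg : P.le 1 g)
    (hgD : ¬ D.Mem g) : 0 < D.n g ∨ D.n g = 0 ∧ 0 < D.m g := by
  have h : ∀ h : P.le 1 g⁻¹, False := fun h ↦ hgD (P.eq_one_of_one_le hg h ▸ Mem.one)
  rcases lt_trichotomy (D.n g) 0 with hn | hn | hn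
  · exact (h (one_le_of_n_pos hx hu (by simpa [n_inv] using hn))).elim
  · refine Or.inr ⟨hn, ?_⟩
    rcases lt_trichotomy (D.m g) 0 with hm | hm | hm
    · exact (h (one_le_of_m_pos hu (by simpa [n_inv] using hn)
        (by simpa [m_inv, hn] using hm))).elim
    · exact (hgD ⟨hn, hm⟩).elim
    · exact hm
  · exact Or.inl hn

theorem one_le_of_pos (hx : P.le 1 D.x) (hu : P.le 1 D.u) {g : G}
    (h : 0 < D.n g ∨ D.n g = 0 ∧ 0 < D.m g) : P.le 1 g := by
  rcases h with h | ⟨hn, hm⟩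
  · exact one_le_of_n_pos hx hu h
  · exact one_le_of_m_pos hu hn hm

/-- The kernel is convex in every left order. -/
theorem one_le_mul_of_mem {g a : G} (hg : P.le 1 g) (hgD : ¬ D.Mem g) (ha : D.Mem a) :
    P.le 1 (g * a) := by
  obtain ⟨D', hD, hx, hu⟩ := D.exists_one_le P
  rw [← hD] at hgD ha
  apply one_le_of_pos hx hu
  simpa [n_mul, m_mul, ha.1, ha.2] using pos_of_one_le hx hu hg hgD

variable (D) in
/-- An order on a Klein extension is isolated if finitely many signs determine it on the
kernel. -/
theorem hasIsolatedLinearOrder (hx : P.le 1 D.x) (hu : P.le 1 D.u) (X : Finset G)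
    (hX : ∀ a ∈ X, P.le 1 a)
    (h : ∀ Q : LeftOrder G, (∀ a ∈ X, Q.le 1 a) → ∀ a, D.Mem a → P.le 1 a → Q.le 1 a) :
    HasIsolatedLinearOrder G := by
  classical
  refine ⟨P, LeftOrder.isIsolated_of_forall_one_le (insert D.x (insert D.u X)) ?_ ?_⟩
  · simpa [hx, hu] using hX
  · intro Q hQ a ha
    simp only [Finset.mem_insert, forall_eq_or_imp] at hQ
    obtain ⟨hQx, hQu, hQX⟩ := hQ
    by_cases haD : D.Mem a
    · exact h Q hQX a haD ha
    · exact one_le_of_pos hQx hQu (pos_of_one_le hx hu ha haD)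

variable (D P) in
/-- The order that compares elements of the kernel first by the values of an additive function
`ψ`, and all other elements like `P`. -/
def modify (ψ : G → ℤ) (hψ : ∀ a b, D.Mem a → D.Mem b → ψ (a * b) = ψ a + ψ b) : LeftOrder G :=
  have hone : ψ 1 = 0 := by
    have := hψ 1 1 Mem.one Mem.one
    rw [mul_one] at this
    omega
  have hinv : ∀ a, D.Mem a → ψ a⁻¹ = - ψ a := fun a ha ↦ by
    have := hψ a a⁻¹ ha ha.inv
    rw [mul_inv_cancel, hone] at this
    omega
  -- Off the kernel the first clause is vacuous and the second reads `P.le 1 a`; ties `ψ a = 0`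
  -- inside the kernel are also settled by `P`. Convexity handles products involving elements off
  -- the kernel, so `ψ` need not be invariant under conjugation.
  LeftOrder.ofCone (fun a ↦ (D.Mem a → 0 ≤ ψ a) ∧ ((D.Mem a → ψ a = 0) → P.le 1 a))
    ⟨fun _ ↦ hone.ge, fun _ ↦ P.le_refl 1⟩
    (fun a b ⟨ha, ha'⟩ ⟨hb, hb'⟩ ↦ by
      by_cases hA : D.Mem a <;> by_cases hB : D.Mem b
      · have := hψ a b hA hB
        have h1 := ha hA
        have h2 := hb hB
        refine ⟨fun _ ↦ by omega, fun h ↦ ?_⟩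
        have h3 := h (hA.mul hB)
        exact P.one_le_mul (ha' fun _ ↦ by omega) (hb' fun _ ↦ by omega)
      · have hAB : ¬ D.Mem (a * b) := fun h ↦ hB (by simpa using hA.inv.mul h)
        refine ⟨fun h ↦ (hAB h).elim, fun _ ↦ ?_⟩
        have := one_le_mul_of_mem (hb' fun h ↦ (hB h).elim) hB (hA.conj_inv b)
        simpa [mul_assoc] using this
      · have hAB : ¬ D.Mem (a * b) := fun h ↦ hA (by simpa using h.mul hB.inv)
        exact ⟨fun h ↦ (hAB h).elim,
          fun _ ↦ one_le_mul_of_mem (ha' fun h ↦ (hA h).elim) hA hB⟩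
      · have h1 := ha' fun h ↦ (hA h).elim
        have h2 := hb' fun h ↦ (hB h).elim
        refine ⟨fun h ↦ ?_, fun _ ↦ P.one_le_mul h1 h2⟩
        -- If `a b` were in the kernel, convexity would make `b⁻¹ = a (a⁻¹ (a b)⁻¹ a)` nonnegative.
        have h3 := one_le_mul_of_mem h1 hA (h.inv.conj_inv a)
        have h4 : b = 1 := P.eq_one_of_one_le h2 (by simpa [mul_assoc] using h3)
        exact (hB (h4 ▸ Mem.one)).elim)
    (fun a ⟨ha, ha'⟩ ⟨hb, hb'⟩ ↦ by
      have h0 : D.Mem a → ψ a = 0 := fun h ↦ by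
        have h1 := ha h
        have h2 := hb h.inv
        have h3 := hinv a h
        omega
      refine P.eq_one_of_one_le (ha' h0) (hb' fun h ↦ ?_)
      have h' : D.Mem a := by simpa using h.inv
      rw [hinv a h', h0 h', neg_zero])
    (fun a ↦ by
      by_cases hA : D.Mem a
      · have h1 := hinv a hA
        rcases lt_trichotomy (ψ a) 0 with h | h | h
        · exact Or.inr ⟨fun _ ↦ by omega, fun h' ↦ by have := h' hA.inv; omega⟩
        · rcases P.one_le_or_one_le_inv a with h2 | h2
          · exact Or.inl ⟨fun _ ↦ by omega, fun _ ↦ h2⟩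
          · exact Or.inr ⟨fun _ ↦ by omega, fun _ ↦ h2⟩
        · exact Or.inl ⟨fun _ ↦ by omega, fun h' ↦ by have := h' hA; omega⟩
      · have hA' : ¬ D.Mem a⁻¹ := fun h ↦ hA (by simpa using h.inv)
        exact (P.one_le_or_one_le_inv a).imp (fun h ↦ ⟨fun h' ↦ (hA h').elim, fun _ ↦ h⟩)
          (fun h ↦ ⟨fun h' ↦ (hA' h').elim, fun _ ↦ h⟩))

theorem modify_le {ψ : G → ℤ} {hψ} {a b : G} :
    (modify D P ψ hψ).le a b ↔ (D.Mem (a⁻¹ * b) → 0 ≤ ψ (a⁻¹ * b)) ∧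
      ((D.Mem (a⁻¹ * b) → ψ (a⁻¹ * b) = 0) → P.le 1 (a⁻¹ * b)) := Iff.rfl

variable (D) in
/-- A Klein extension has no isolated order if finite subsets of its kernel are killed by nonzero
additive functions. -/
theorem not_hasIsolatedLinearOrder
    (h : ∀ X : Finset G, ∃ ψ : G → ℤ, (∀ a b, D.Mem a → D.Mem b → ψ (a * b) = ψ a + ψ b) ∧
      (∀ a ∈ X, D.Mem a → ψ a = 0) ∧ ∃ a, D.Mem a ∧ ψ a < 0) :
    ¬ HasIsolatedLinearOrder G := by
  classical
  rintro ⟨P, hP⟩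
  obtain ⟨X, hX⟩ := P.isIsolated_iff.1 hP
  obtain ⟨ψ, hψ, h0, a, ha, hneg⟩ := h ((X ×ˢ X).image fun p ↦ p.1⁻¹ * p.2)
  -- Applied to both `ψ` and `-ψ`: each modification agrees with `P` on `X`, hence equals `P`, yet
  -- the two differ in the sign of `a`.
  have agree (φ : G → ℤ) (hφ) (hφ0 : ∀ a, D.Mem a → ψ a = 0 → φ a = 0) :
      modify D P φ hφ = P := by
    refine hX _ fun x hx y hy ↦ ?_
    have hxy : D.Mem (x⁻¹ * y) → φ (x⁻¹ * y) = 0 := fun hxy ↦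
      hφ0 _ hxy (h0 _ (Finset.mem_image.2 ⟨(x, y), by simp [hx, hy], rfl⟩) hxy)
    rw [modify_le, P.le_iff_one_le x y]
    exact ⟨fun h ↦ h.2 hxy, fun h ↦ ⟨fun h' ↦ (hxy h').ge, fun _ ↦ h⟩⟩
  have h1 := agree ψ hψ fun _ _ h ↦ h
  have h2 := agree (fun a ↦ - ψ a) (fun a b ha hb ↦ by rw [hψ a b ha hb]; ring)
    fun _ _ h ↦ by simp [h]
  have h3 : (modify D P (fun a ↦ - ψ a) (fun a b ha hb ↦ by rw [hψ a b ha hb]; ring)).le 1 a := by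
    rw [modify_le]
    simp only [inv_one, one_mul]
    exact ⟨fun _ ↦ by omega, fun h ↦ by have := h ha; omega⟩
  rw [h2, ← h1, modify_le] at h3
  simp only [inv_one, one_mul] at h3
  have := h3.1 ha
  omega

end KleinExtension

/-! ### Affine groups over the Klein bottle group -/

/-- The group of triples `(r, m, n)`, representing `r * u ^ m * x ^ n`, where `x` and `u` generate
the Klein bottle group, acting on the additive group of `R` by `x • r = t r` and `u • r = -r`. -/
@[ext]
structure AffineKlein {R : Type*} [CommRing R] (t : Rˣ) where
  r : R
  m : ℤ
  n : ℤ

namespace AffineKlein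

variable {R : Type*} [CommRing R] {t : Rˣ}

/-- The twist in the `m`-coordinate preserves parity, which is all that the action of `u ^ m` sees.
-/
theorem negOnePow_unit_mul (ε : ℤˣ) (m : ℤ) : ((ε : ℤ) * m).negOnePow = m.negOnePow := by
  rcases Int.units_eq_one_or ε with rfl | rfl <;> simp

instance : Mul (AffineKlein t) :=
  ⟨fun a b ↦ ⟨a.r + ((a.m.negOnePow : ℤ) : R) * ((t ^ a.n : Rˣ) : R) * b.r,
    a.m + (a.n.negOnePow : ℤ) * b.m, a.n + b.n⟩⟩

instance : One (AffineKlein t) := ⟨⟨0, 0, 0⟩⟩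

instance : Inv (AffineKlein t) :=
  ⟨fun a ↦ ⟨-(((a.m.negOnePow : ℤ) : R) * ((t ^ (-a.n) : Rˣ) : R) * a.r),
    -((a.n.negOnePow : ℤ) * a.m), -a.n⟩⟩

@[simp] theorem mul_r (a b : AffineKlein t) :
    (a * b).r = a.r + ((a.m.negOnePow : ℤ) : R) * ((t ^ a.n : Rˣ) : R) * b.r := rfl
@[simp] theorem mul_m (a b : AffineKlein t) : (a * b).m = a.m + (a.n.negOnePow : ℤ) * b.m := rfl
@[simp] theorem mul_n (a b : AffineKlein t) : (a * b).n = a.n + b.n := rfl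
@[simp] theorem one_r : (1 : AffineKlein t).r = 0 := rfl
@[simp] theorem one_m : (1 : AffineKlein t).m = 0 := rfl
@[simp] theorem one_n : (1 : AffineKlein t).n = 0 := rfl
@[simp] theorem inv_r (a : AffineKlein t) :
    a⁻¹.r = -(((a.m.negOnePow : ℤ) : R) * ((t ^ (-a.n) : Rˣ) : R) * a.r) := rfl
@[simp] theorem inv_m (a : AffineKlein t) : a⁻¹.m = -((a.n.negOnePow : ℤ) * a.m) := rfl
@[simp] theorem inv_n (a : AffineKlein t) : a⁻¹.n = -a.n := rfl

instance : Group (AffineKlein t) :=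
  Group.ofLeftAxioms
    (fun a b c ↦ by
      ext
      · simp only [mul_r, mul_m, mul_n, Int.negOnePow_add, negOnePow_unit_mul, zpow_add,
          Units.val_mul, Int.cast_mul]
        ring
      · simp only [mul_m, mul_n, Int.negOnePow_add, Units.val_mul]
        ring
      · simp only [mul_n]
        ring)
    (fun a ↦ by ext <;> simp)
    (fun a ↦ by
      ext
      · simp only [mul_r, inv_r, inv_m, inv_n, Int.negOnePow_neg, negOnePow_unit_mul, one_r]
        ring
      · simp
      · simp)

/-- The stable letter, acting as multiplication by `t`. -/
def x (t : Rˣ) : AffineKlein t := ⟨0, 0, 1⟩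

/-- An element acting as `-1`. -/
def u (t : Rˣ) : AffineKlein t := ⟨1, 1, 0⟩

@[simp] theorem x_r : (x t).r = 0 := rfl
@[simp] theorem x_m : (x t).m = 0 := rfl
@[simp] theorem x_n : (x t).n = 1 := rfl
@[simp] theorem u_r : (u t).r = 1 := rfl
@[simp] theorem u_m : (u t).m = 1 := rfl
@[simp] theorem u_n : (u t).n = 0 := rfl

/-- Subgroups containing `x` and `u` are Klein extensions. -/
def extension {G : Type*} [Group G] (f : G →* AffineKlein t) (hf : Function.Injective f)
    (gx gu : G) (hx : f gx = x t) (hu : f gu = u t) : KleinExtension G where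
  n a := (f a).n
  m a := (f a).m
  x := gx
  u := gu
  n_mul a b := by simp
  m_mul a b := by simp
  n_x := by simp [hx]
  n_u := by simp [hu]
  m_u := by simp [hu]
  u_mul a hn hm := hf (by
    ext
    · simp [hu, hn, hm]
      ring
    · simp [hu, hn, hm]
    · simp [hu, hn])

/-- Functoriality in the ring. -/
def map {S : Type*} [CommRing S] {s : Sˣ} (σ : R →+* S) (h : Units.map σ t = s) :
    AffineKlein t →* AffineKlein s where
  toFun a := ⟨σ a.r, a.m, a.n⟩
  map_one' := by ext <;> simp
  map_mul' a b := by
    subst h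
    ext
    · simp only [mul_r, map_add, map_mul, map_intCast, ← map_zpow, Units.coe_map]
      rfl
    · rfl
    · rfl

/-- The commutator-like element `x u x⁻¹ u` of the kernel. -/
theorem x_mul_u : x t * u t * (x t)⁻¹ * u t = ⟨t - 1, 0, 0⟩ := by
  ext <;> simp
  ring

theorem x_conj_zpow (k : ℤ) (r : R) :
    x t ^ k * ⟨r, 0, 0⟩ * (x t ^ k)⁻¹ = ⟨((t ^ k : Rˣ) : R) * r, 0, 0⟩ := by
  have h : x t ^ k = ⟨0, 0, k⟩ := by
    have hn (k : ℕ) : x t ^ k = ⟨0, 0, k⟩ := by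
      induction k with
      | zero => rfl
      | succ k ih => rw [pow_succ, ih]; ext <;> simp
    obtain ⟨k, rfl | rfl⟩ := k.eq_nat_or_neg
    · exact_mod_cast hn k
    · rw [zpow_neg, zpow_natCast, hn]
      ext <;> simp
  rw [h]
  ext <;> simp

/-- The words in `x` and `u`, with all other generators trivial. -/
def word (t : Rˣ) (n : ℕ) : FreeGroup (Fin n) →* AffineKlein t :=
  FreeGroup.lift fun j ↦ if j.val = 0 then x t else if j.val = 1 then u t else 1

/-- Lets words be computed once over Laurent polynomials and then specialised. -/
theorem map_word {S : Type*} [CommRing S] {s : Sˣ} (σ : R →+* S) (h : Units.map σ t = s) (n : ℕ)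
    (w : FreeGroup (Fin n)) : map σ h (word t n w) = word s n w := by
  rw [← MonoidHom.comp_apply]
  congr 1
  ext j : 1
  subst h
  simp only [word, MonoidHom.comp_apply, FreeGroup.lift_apply_of]
  split_ifs
  · ext <;> simp [map]
  · ext <;> simp [map]
  · simp

/-- The lexicographic left order over the rationals. -/
def lex (t : ℚˣ) : LeftOrder (AffineKlein t) :=
  LeftOrder.ofCone (fun a ↦ 0 < a.n ∨ a.n = 0 ∧ (0 < a.m ∨ a.m = 0 ∧ 0 ≤ a.r))
    (by simp)
    (fun a b ha hb ↦ by
      rcases ha with ha | ⟨ha, ha'⟩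
      · left
        rw [mul_n]
        omega
      rcases hb with hb | ⟨hb, hb'⟩
      · left
        rw [mul_n]
        omega
      refine Or.inr ⟨by simp [ha, hb], ?_⟩
      rcases ha' with ha' | ⟨ha', ha''⟩
      · left
        simp [ha]
        omega
      rcases hb' with hb' | ⟨hb', hb''⟩
      · left
        simp [ha]
        omega
      · right
        simp [ha, ha', hb']
        positivity)
    (fun a ha ha' ↦ by
      simp only [inv_n, inv_m, inv_r] at ha'
      have hn : a.n = 0 := by omega
      simp only [hn, lt_irrefl, neg_zero, Int.negOnePow_zero, Units.val_one, one_mul,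
        true_and, false_or, zpow_zero, mul_one] at ha ha'
      have hm : a.m = 0 := by omega
      simp [hm] at ha ha'
      ext
      · exact le_antisymm ha' ha
      · exact hm
      · exact hn)
    (fun a ↦ by
      simp only [inv_n, inv_m, inv_r]
      rcases lt_trichotomy a.n 0 with hn | hn | hn
      · right; left; omega
      · simp only [hn, lt_irrefl, neg_zero, Int.negOnePow_zero, Units.val_one, one_mul,
          true_and, false_or, zpow_zero, mul_one]
        rcases lt_trichotomy a.m 0 with hm | hm | hm
        · right; left; omega
        · simpa [hm] using le_total 0 a.r
        · left; left; exact hm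
      · left; left; exact hn)

theorem lex_le {t : ℚˣ} {a : AffineKlein t} :
    (lex t).le 1 a ↔ 0 < a.n ∨ a.n = 0 ∧ (0 < a.m ∨ a.m = 0 ∧ 0 ≤ a.r) := by
  rw [lex, LeftOrder.ofCone_le]
  simp

theorem pow_of_kernel (r : R) (k : ℕ) : (⟨r, 0, 0⟩ : AffineKlein t) ^ k = ⟨k * r, 0, 0⟩ := by
  induction k with
  | zero => ext <;> simp
  | succ k ih =>
    rw [pow_succ, ih]
    ext <;> simp
    ring

/-- In the rational case, the kernel has rank one, and so there is an isolated order. -/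
theorem hasIsolatedLinearOrder {t : ℚˣ} (ht : 1 < (t : ℚ)) {G : Type*} [Group G]
    (f : G →* AffineKlein t) (hf : Function.Injective f)
    (gx gu : G) (hx : f gx = x t) (hu : f gu = u t) : HasIsolatedLinearOrder G := by
  let c := gx * gu * gx⁻¹ * gu
  have hc : f c = ⟨t - 1, 0, 0⟩ := by
    rw [← x_mul_u]
    simp [c, hx, hu]
  have hlex (a : G) : (LeftOrder.comap f hf (lex t)).le 1 a ↔ (lex t).le 1 (f a) := by
    change (lex t).le (f 1) (f a) ↔ _
    rw [map_one]
  refine KleinExtension.hasIsolatedLinearOrder (extension f hf gx gu hx hu)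
    (P := LeftOrder.comap f hf (lex t)) ?_ ?_ {c} ?_ ?_
  · change (LeftOrder.comap f hf (lex t)).le 1 gx
    simp [hlex, lex_le, hx]
  · change (LeftOrder.comap f hf (lex t)).le 1 gu
    simp [hlex, lex_le, hu]
  · simp [hlex, lex_le, hc]
    linarith
  · rintro Q hQ a ⟨hn, hm⟩ ha
    replace hQ := hQ c (by simp)
    change (f a).n = 0 at hn
    change (f a).m = 0 at hm
    have ha' : 0 ≤ (f a).r := by simpa [hlex, lex_le, hn, hm] using ha
    have hfa : f a = ⟨(f a).r, 0, 0⟩ := by ext <;> simp [hn, hm]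
    obtain ⟨k, l, hkl⟩ : ∃ k l : ℕ, ((k + 1 : ℕ) : ℚ) * (f a).r = l * (t - 1) := by
      have hq : 0 ≤ (f a).r / (t - 1) := div_nonneg ha' (by linarith)
      obtain ⟨l, hl⟩ := Int.eq_ofNat_of_zero_le (Rat.num_nonneg.2 hq)
      -- Reduced fraction of `r / (t - 1)`; the denominator is written `k + 1` to keep it positive.
      refine ⟨((f a).r / (t - 1)).den - 1, l, ?_⟩
      rw [Nat.sub_add_cancel ((f a).r / (t - 1)).den_pos]
      have h1 := Rat.den_mul_eq_num ((f a).r / (t - 1))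
      rw [hl] at h1
      have h2 : (t : ℚ) - 1 ≠ 0 := by linarith
      rw [mul_div_assoc', div_eq_iff h2] at h1
      exact_mod_cast h1
    -- A positive power of `a` is a power of `c`, so the sign of `c` decides that of `a`, by
    -- torsion-freeness.
    have hpow : a ^ (k + 1) = c ^ l := hf (by
      rw [map_pow, map_pow, hc, hfa, pow_of_kernel, pow_of_kernel, hkl])
    rcases Q.one_le_or_one_le_inv a with h | h
    · exact h
    · have h1 : a ^ (k + 1) = 1 := Q.eq_one_of_one_le (hpow ▸ Q.one_le_pow hQ l)
        (by simpa using Q.one_le_pow h (k + 1))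
      rw [Q.eq_one_of_pow_eq_one h1]
      exact Q.le_refl 1

/-! ### The Laurent group as a limit of rational groups -/

open LaurentPolynomial

/-- The variable of the ring of Laurent polynomials, as a unit. -/
noncomputable def unitT : (ℤ[T;T⁻¹])ˣ where
  val := T 1
  inv := T (-1)
  val_inv := by rw [← T_add, add_neg_cancel, T_zero]
  inv_val := by rw [← T_add, neg_add_cancel, T_zero]

theorem unitT_zpow (k : ℤ) : ((unitT ^ k : (ℤ[T;T⁻¹])ˣ) : ℤ[T;T⁻¹]) = T k := by
  have hn (k : ℕ) : ((unitT ^ k : (ℤ[T;T⁻¹])ˣ) : ℤ[T;T⁻¹]) = T k := by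
    simp [unitT, T_pow]
  obtain ⟨k, rfl | rfl⟩ := k.eq_nat_or_neg
  · exact_mod_cast hn k
  · rw [zpow_neg, zpow_natCast, Units.inv_eq_of_mul_eq_one_right]
    rw [hn, ← T_add, add_neg_cancel, T_zero]

/-- Take for `ψ` the coefficient at an exponent `k` absent from the finite set. It is nonzero on the
kernel: conjugating the translation by `T - 1` with `x ^ k` gives `T ^ (k + 1) - T ^ k`, with
coefficient `-1`. -/
theorem not_hasIsolatedLinearOrder {G : Type*} [Group G]
    (f : G →* AffineKlein unitT) (hf : Function.Injective f)
    (gx gu : G) (hx : f gx = x unitT) (hu : f gu = u unitT) : ¬ HasIsolatedLinearOrder G := by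
  classical
  refine KleinExtension.not_hasIsolatedLinearOrder (extension f hf gx gu hx hu) fun X ↦ ?_
  obtain ⟨k, hk⟩ := Infinite.exists_notMem_finset (X.biUnion fun a ↦ (f a).r.coeff.support)
  refine ⟨fun a ↦ (f a).r.coeff k, ?_, ?_, gx ^ k * (gx * gu * gx⁻¹ * gu) * (gx ^ k)⁻¹, ?_⟩
  · rintro a b ⟨hn, hm⟩ -
    change (f a).n = 0 at hn
    change (f a).m = 0 at hm
    simp [hn, hm]
  · intro a ha _
    by_contra h
    exact hk (Finset.mem_biUnion.2 ⟨a, ha, Finsupp.mem_support_iff.2 h⟩)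
  · have : f (gx ^ k * (gx * gu * gx⁻¹ * gu) * (gx ^ k)⁻¹) = ⟨T k * (T 1 - 1), 0, 0⟩ := by
      simp only [map_mul, map_inv, map_zpow, hx, hu]
      rw [x_mul_u, x_conj_zpow, unitT_zpow]
      rfl
    refine ⟨⟨?_, ?_⟩, ?_⟩
    · change (f _).n = 0
      rw [this]
    · change (f _).m = 0
      rw [this]
    · change (f _).r.coeff k < 0
      rw [this, mul_sub, mul_one, ← T_add]
      simp

/-- The integer `k + 2` as a rational unit. -/
def ratUnit (k : ℕ) : ℚˣ := Units.mk0 (k + 2) (by positivity)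

/-- Evaluation of Laurent polynomials at `k + 2`. -/
noncomputable def evalAt (k : ℕ) : ℤ[T;T⁻¹] →+* ℚ := eval₂ (Int.castRingHom ℚ) (ratUnit k)

theorem map_evalAt (k : ℕ) : Units.map (evalAt k) unitT = ratUnit k := by
  ext
  change evalAt k (T 1) = _
  rw [evalAt, eval₂_T, zpow_one]

-- Clearing denominators by a power of `T` leaves a nonzero polynomial, which has finitely many
-- roots among the distinct points `k + 2`.
open Filter in
theorem eventually_evalAt_ne_zero {p : ℤ[T;T⁻¹]} (hp : p ≠ 0) :
    ∀ᶠ k in atTop, evalAt k p ≠ 0 := by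
  obtain ⟨l, q, hq⟩ := exists_T_pow p
  have hq0 : q.map (Int.castRingHom ℚ) ≠ 0 := by
    rw [Polynomial.map_ne_zero_iff (RingHom.injective_int _)]
    rintro rfl
    rw [map_zero] at hq
    exact hp ((isUnit_T (R := ℤ) l).mul_left_eq_zero.1 hq.symm)
  have hinj : Function.Injective fun k : ℕ ↦ ((k : ℚ) + 2) := fun a b h ↦ by
    simpa using h
  have hfin := ((q.map (Int.castRingHom ℚ)).roots.toFinset.finite_toSet).preimage hinj.injOn
  rw [← Nat.cofinite_eq_atTop]
  filter_upwards [hfin.compl_mem_cofinite] with k hk h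
  apply hk
  simp only [Set.mem_preimage, Finset.mem_coe, Multiset.mem_toFinset,
    Polynomial.mem_roots hq0, Polynomial.IsRoot.def, Polynomial.eval_map]
  have := congrArg (evalAt k) hq
  rw [map_mul, h, zero_mul, evalAt, eval₂_toLaurent] at this
  exact this

-- Relations persist under evaluation. A nontrivial value is seen either in `m` or `n`, which
-- evaluation preserves, or in a nonzero `r`, which eventually stays nonzero.
open Filter in
theorem eventually_word_eq_one_iff (n : ℕ) (w : FreeGroup (Fin n)) :
    ∀ᶠ k in atTop, (word (ratUnit k) n w = 1 ↔ word unitT n w = 1) := by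
  by_cases h : word unitT n w = 1
  · refine Eventually.of_forall fun k ↦ ?_
    rw [← map_word (evalAt k) (map_evalAt k), h]
    simp
  · have : ∀ᶠ k in atTop, map (evalAt k) (map_evalAt k) (word unitT n w) ≠ 1 := by
      by_cases hr : (word unitT n w).r = 0
      · refine Eventually.of_forall fun k hk ↦ h ?_
        ext1
        · exact hr
        · exact congrArg (fun a : AffineKlein (ratUnit k) ↦ a.m) hk
        · exact congrArg (fun a : AffineKlein (ratUnit k) ↦ a.n) hk
      · filter_upwards [eventually_evalAt_ne_zero hr] with k hk hk'
        exact hk (congrArg AffineKlein.r hk')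
    filter_upwards [this] with k hk
    rw [map_word] at hk
    exact iff_of_false hk h

theorem not_isClosed_hasIsolatedLinearOrder {n : ℕ} (hn : 2 ≤ n) :
    ¬ IsClosed {M : MarkedGroup n | HasIsolatedLinearOrder M.Carrier} := by
  intro hC
  let gx : FreeGroup (Fin n) := FreeGroup.of ⟨0, by omega⟩
  let gu : FreeGroup (Fin n) := FreeGroup.of ⟨1, by omega⟩
  have hx {R : Type} [CommRing R] (t : Rˣ) : word t n gx = x t := by simp [word, gx]
  have hu {R : Type} [CommRing R] (t : Rˣ) : word t n gu = u t := by simp [word, gu]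
  obtain ⟨k, hk⟩ := MarkedGroup.exists_mem_of_isOpen hC.isOpen_compl
    (M := MarkedGroup.ofHom (word unitT n))
    (not_hasIsolatedLinearOrder (QuotientGroup.kerLift (word unitT n))
      (QuotientGroup.kerLift_injective _) gx gu (hx _) (hu _))
    (fun k ↦ MarkedGroup.ofHom (word (ratUnit k) n)) (eventually_word_eq_one_iff n)
  refine hk (hasIsolatedLinearOrder (t := ratUnit k) ?_
    (QuotientGroup.kerLift (word (ratUnit k) n)) (QuotientGroup.kerLift_injective _) gx gu
    (hx _) (hu _))
  change (1 : ℚ) < k + 2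
  have : (0 : ℚ) ≤ k := k.cast_nonneg
  linarith

end AffineKlein

theorem corollary1p3 :
    (¬ IsClosed {M : FGMarkedGroup | HasIsolatedLinearOrder M.2.Carrier} ∧
      ¬ IsOpen {M : FGMarkedGroup | HasIsolatedLinearOrder M.2.Carrier}) ∧
    ∀ n : ℕ, 2 ≤ n →
      ¬ IsClosed {M : MarkedGroup n | HasIsolatedLinearOrder M.Carrier} ∧
      ¬ IsOpen {M : MarkedGroup n | HasIsolatedLinearOrder M.Carrier} := by
  refine ⟨⟨fun h ↦ ?_, fun h ↦ ?_⟩, fun n hn ↦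
    ⟨AffineKlein.not_isClosed_hasIsolatedLinearOrder hn,
      not_isOpen_hasIsolatedLinearOrder (by omega)⟩⟩
  · exact AffineKlein.not_isClosed_hasIsolatedLinearOrder le_rfl
      (isClosed_sigma_iff.1 h 2)
  · exact not_isOpen_hasIsolatedLinearOrder one_le_two (isOpen_sigma_iff.1 h 2)
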